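/- **Setting.** Let $T$ be a number of time intervals, $\mathcal G$ a finite set of generators, $\mathcal S$ a finite set of storage units, and $d\in\mathbb R^T$ an inelastic demand. Generator $j$ has cost $\frac{c_j}{2}g_j^Tg_j$ with $c_j>0$ for its output $g_j\in\mathbb R^T$. Storage unit $i$ has capacity $E_i>0$, initial state of charge $x_{o,i}$ and charge/discharge rates $u_i\in\mathbb R^T$ (discharge positive). Its state of charge $x_i\in\mathbb R^{T+1}$ is $x_{i,0}=x_{o,i}$, $x_{i,t}=x_{i,t-1}-u_{i,t}/E_i$. Let $\nu_i=\mathrm{Rainflow}(x_i)\in\mathbb R^T$ be the vector of half-cycle depths that the Rainflow algorithm counts in $x_i$ (as long as some four consecutive switching points have a middle change that is the smallest of their three changes, a full cycle, i.e. two half-cycles, of that depth is extracted and its two points are removed; the remaining changes are half-cycles; the vector is filled up with zeros). The storage cost is $C_i(u_i)=\frac{b_i}{2}\nu_i^T\nu_i$ with $b_i>0$. Put $N(u_i)=-\frac1{E_i}M(x_i)^TA^\dagger$, where $M(x_i)\in\mathbb R^{(T+1)\times T}$ is the incidence matrix of the graph with one edge per counted half-cycle, directed from its larger to its smaller state of charge,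 and $A^\dagger$ is the Moore–Penrose inverse of the difference matrix $A\in\mathbb R^{T\times(T+1)}$, $(Ax)_t=x_t-x_{t-1}$. Call $(g,u)$ *feasible* if $d=\sum_jg_j+\sum_iu_i$, $\underline g_j\le g_{j,t}\le\overline g_j$, $\underline u_i\le u_{i,t}\le\overline u_i$, $\mathbf 1^Tu_i=0$ and $(x_{o,i}-1)\mathbf 1\le\tilde A_iu_i\le x_{o,i}\mathbf 1$, where $\tilde A_i$ is $\frac1{E_i}$ times the lower triangular all-ones matrix. *SOCIAL PLANNER:* minimize $\sum_iC_i(u_i)+\sum_j\frac{c_j}{2}g_j^Tg_j$ over feasible $(g,u)$. *CYCLE AWARE SYSTEM* for bids $\alpha_j,\beta_i>0$: minimize $\sum_i\frac1{2\beta_i}v_i^Tv_i+\sum_j\frac1{2\alpha_j}g_j^Tg_j$ over feasible $(g,u)$ and $v_i=N(u_i)u_i$. **Mechanism.** The generators bid supply functions $g_j=\alpha_j\Theta_j$, and the storage units bid energy-cycling functions $\nu_i=\beta_i\theta_i$ of the per-cycle prices $\theta_i\in\mathbb R^T$. A *clearing* for bids $\alpha,\beta>0$ is an optimal solution $(g,u,v)$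 of the CYCLE AWARE SYSTEM with dual variables: $\lambda\in\mathbb R^T$ for the power balance, $\theta_i$ for the Rainflow constraint, $\delta_i\in\mathbb R$ for periodicity, and nonnegative $\underline\eta_j,\overline\eta_j$ (generation limits), $\underline\mu_i,\overline\mu_i$ (state-of-charge limits), $\underline\nu_i,\overline\nu_i$ (rate limits) that satisfy complementary slackness and $\lambda=g_j/\alpha_j+\overline\eta_j-\underline\eta_j$, $\theta_i=v_i/\beta_i$, and $\lambda-\delta_i\mathbf 1-\tilde A_i^T(\overline\mu_i-\underline\mu_i)-(\overline\nu_i-\underline\nu_i)$ is a subgradient at $u_i$ of $u\mapsto\frac1{2\beta_i}\lVert N(u)u\rVert^2$. Generator $j$ is paid at the price $\Theta_j=\lambda+\underline\eta_j-\overline\eta_j$, storage unit $i$ at the price $\theta_i$. Price-taking participants maximize, over bids $\alpha\ge0$ and $\beta\ge0$ at given prices, the profits $\Theta_j^T(\alpha\Theta_j)-\frac{c_j}{2}\lVert\alpha\Theta_j\rVert^2$ and $\theta_i^T(\beta\theta_i)-\frac{b_i}{2}\lVert\beta\theta_i\rVert^2$. A *competitive equilibrium* consists of bids $\alpha,\beta>0$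 and a clearing for them such that every bid maximizes its owner's profit at the cleared prices, $N(u_i)u_i=\beta_i\theta_i$ for all $i$, and $d=\sum_j\alpha_j\Theta_j+\sum_iu_i$. **Theorem.** 1. The truthful bids $\alpha_j=1/c_j$ and $\beta_i=1/b_i$ maximize the profits at all prices $\Theta_j,\theta_i\in\mathbb R^T$ (so they do not depend on the prices), and they are the only maximizers at nonzero prices. 2. In every competitive equilibrium $\alpha_j=1/c_j$ whenever $\Theta_j\ne0$ and $\beta_i=1/b_i$ whenever $\theta_i\ne0$, and the dispatch $(g,u)$ is an optimal solution of the SOCIAL PLANNER problem; that is, the equilibrium minimizes social cost. 3. Every clearing for the truthful bids is, with these bids, a competitive equilibrium. 4. $(g,u,v)$ is an optimal solution of the CYCLE AWARE SYSTEM for the truthful bids if and only if $(g,u)$ is an optimal solution of the SOCIAL PLANNER problem and $v_i=\mathrm{Rainflow}(x_i)$ for all $i$. -/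

import Mathlib

open scoped Matrix

noncomputable section

namespace CycleMarket

/-! ### The Rainflow cycle counting algorithm

A state-of-charge (SoC) profile over `T` intervals is a vector `x : Fin (T + 1) → ℝ`. -/

/-- One step of the identification of the switching times. The list holds the switching times found
so far, the latest one first; `t` is the next time. A time at which the SoC has not moved is
skipped, and a time which continues a charging or discharging phase replaces the last one. -/
def addTime {T : ℕ} (x : Fin (T + 1) → ℝ) :
    List (Fin (T + 1)) → Fin (T + 1) → List (Fin (T + 1))
  | [], t => [t]
  | [a], t => if x t = x a then [a] else [t, a]
  | a :: b :: l, t =>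
      if x t = x a then a :: b :: l
      else if (x b < x a ∧ x a < x t) ∨ (x t < x a ∧ x a < x b) then t :: b :: l
      else t :: a :: b :: l

/-- The switching times of the profile `x` in chronological order: the initial time, the times at
which `x` switches between charging and discharging, and the time at which it reaches its terminal
value. -/
def switchingTimes {T : ℕ} (x : Fin (T + 1) → ℝ) : List (Fin (T + 1)) :=
  ((List.finRange (T + 1)).foldl (addTime x) []).reverse

/-- Search for the first four consecutive switching times `s₁, s₂, s₃, s₄` such that the middle
change `Δ₂ = |x s₂ - x s₃|` is the smallest of the three changes. The result is `s₂, s₃` and the list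
of times from which these two are removed. -/
def extractCycle {T : ℕ} (x : Fin (T + 1) → ℝ) :
    List (Fin (T + 1)) → Option ((Fin (T + 1) × Fin (T + 1)) × List (Fin (T + 1)))
  | s₁ :: s₂ :: s₃ :: s₄ :: l =>
      if |x s₂ - x s₃| ≤ |x s₁ - x s₂| ∧ |x s₂ - x s₃| ≤ |x s₃ - x s₄| then
        some ((s₂, s₃), s₁ :: s₄ :: l)
      else
        (extractCycle x (s₂ :: s₃ :: s₄ :: l)).map fun r => (r.1, s₁ :: r.2)
  | _ => none

/-- The half-cycles, as pairs of times, counted in a list of switching times: full cycles are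
extracted as long as there are any, each contributing a charging and a discharging half-cycle, and
then the remaining consecutive times are half-cycles. The first argument bounds the number of
extractions; each of them removes two times, so the length of the list is always enough. -/
def countCycles {T : ℕ} (x : Fin (T + 1) → ℝ) :
    ℕ → List (Fin (T + 1)) → List (Fin (T + 1) × Fin (T + 1))
  | 0, l => l.zip l.tail
  | n + 1, l =>
      match extractCycle x l with
      | none => l.zip l.tail
      | some (p, l') => p :: p :: countCycles x n l'

/-- The half-cycles of the profile `x`, in the order in which the Rainflow algorithm finds them.
There are at most `T` of them. -/
def halfCycles {T : ℕ} (x : Fin (T + 1) → ℝ) : List (Fin (T + 1) × Fin (T + 1)) :=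
  countCycles x (switchingTimes x).length (switchingTimes x)

/-- The vector `Rainflow(x)` of half-cycle depths, filled up with zeros. -/
def rainflow {T : ℕ} (x : Fin (T + 1) → ℝ) : Fin T → ℝ := fun k =>
  match (halfCycles x)[(k : ℕ)]? with
  | none => 0
  | some (s, t) => |x s - x t|

/-- The incidence matrix `M(x)` of the directed graph whose edges are the half-cycles. Each edge
starts at the time with the larger SoC. Columns without half-cycle are zero. -/
def incidence {T : ℕ} (x : Fin (T + 1) → ℝ) : Matrix (Fin (T + 1)) (Fin T) ℝ :=
  Matrix.of fun r k =>
    match (halfCycles x)[(k : ℕ)]? with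
    | none => 0
    | some (s, t) =>
        if x t ≤ x s then (Pi.single s 1 - Pi.single t 1 : Fin (T + 1) → ℝ) r
        else (Pi.single t 1 - Pi.single s 1 : Fin (T + 1) → ℝ) r

/-! ### Storage dynamics -/

/-- The `T × (T + 1)` difference matrix `A`, with `(A x)_t = x_{t+1} - x_t`. -/
def diffMatrix (T : ℕ) : Matrix (Fin T) (Fin (T + 1)) ℝ :=
  Matrix.of fun t s => if s = t.succ then 1 else if s = t.castSucc then -1 else 0

/-- The Moore–Penrose inverse `A† = Aᵀ (A Aᵀ)⁻¹` of `A`, which has full row rank. -/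
def diffPinv (T : ℕ) : Matrix (Fin (T + 1)) (Fin T) ℝ :=
  (diffMatrix T)ᵀ * (diffMatrix T * (diffMatrix T)ᵀ)⁻¹

theorem vecMul_diffMatrix_injective (T : ℕ) (w : Fin T → ℝ) (h : w ᵥ* diffMatrix T = 0) : w = 0 := by
  funext k
  have key : ∀ n (hn : n < T), w ⟨n, hn⟩ = 0 := by
    intro n
    induction n with
    | zero =>
      intro hn
      have := congrFun h (Fin.castSucc ⟨0, hn⟩)
      simp only [Matrix.vecMul, dotProduct, diffMatrix, Matrix.of_apply, Pi.zero_apply] at this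
      rw [Finset.sum_eq_single ⟨0, hn⟩] at this
      · simpa [Fin.ext_iff] using this
      · intro b _ hb
        have : (b : ℕ) ≠ 0 := fun h => hb (Fin.ext h)
        simp [Fin.ext_iff, this.symm]
      · simp
    | succ n ih =>
      intro hn
      have := congrFun h (Fin.castSucc ⟨n + 1, hn⟩)
      simp only [Matrix.vecMul, dotProduct, diffMatrix, Matrix.of_apply, Pi.zero_apply] at this
      rw [Finset.sum_eq_single ⟨n + 1, hn⟩] at this
      · simpa [Fin.ext_iff] using this
      · intro b _ hb
        by_cases hbn : (b : ℕ) = n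
        · have : b = ⟨n, by omega⟩ := Fin.ext hbn
          rw [this, ih]; simp
        · have : (b : ℕ) ≠ n + 1 := fun h => hb (Fin.ext h)
          simp [Fin.ext_iff, this.symm, Ne.symm hbn]
      · simp
  exact key k k.2

theorem isUnit_det_diffMatrix (T : ℕ) : IsUnit (diffMatrix T * (diffMatrix T)ᵀ).det := by
  have h := Matrix.PosDef.mul_conjTranspose_self (diffMatrix T) (by
    intro a b hab
    have : (a - b) ᵥ* diffMatrix T = 0 := by
      rw [Matrix.sub_vecMul]; exact sub_eq_zero.2 hab
    exact sub_eq_zero.1 (vecMul_diffMatrix_injective T _ this))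
  rw [Matrix.conjTranspose_eq_transpose_of_trivial] at h
  exact h.det_pos.ne'.isUnit

/-- `diffPinv T` is the Moore–Penrose inverse of `A`: it is a right inverse, and `A† A` is symmetric. -/
theorem diffPinv_isMoorePenrose (T : ℕ) :
    diffMatrix T * diffPinv T = 1 ∧ (diffPinv T * diffMatrix T)ᵀ = diffPinv T * diffMatrix T := by
  constructor
  · rw [diffPinv, ← Matrix.mul_assoc, Matrix.mul_nonsing_inv _ (isUnit_det_diffMatrix T)]
  · simp [diffPinv, Matrix.transpose_mul, Matrix.transpose_nonsing_inv, Matrix.mul_assoc]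

/-- The SoC profile of a storage unit of capacity `E` with initial SoC `x₀` and charge/discharge
rates `u`: `x_t = x_{t-1} - u_t / E`. -/
def soc {T : ℕ} (E x₀ : ℝ) (u : Fin T → ℝ) : Fin (T + 1) → ℝ := fun t =>
  x₀ - (1 / E) * ∑ s : Fin T, if s.castSucc < t then u s else 0

/-- The matrix `N(u) = -(1/E) M(x)ᵀ A†`, where `x` is the SoC profile of `u`. -/
def cycleMatrix {T : ℕ} (E x₀ : ℝ) (u : Fin T → ℝ) : Matrix (Fin T) (Fin T) ℝ :=
  (-(1 / E)) • ((incidence (soc E x₀ u))ᵀ * diffPinv T)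

/-- The lower triangular matrix `Ã`, with all entries on and below the diagonal equal to `1/E`. -/
def cumMatrix (T : ℕ) (E : ℝ) : Matrix (Fin T) (Fin T) ℝ :=
  Matrix.of fun t s => if s ≤ t then 1 / E else 0

/-! ### The market -/

/-- The data of the multi-interval market with generators `G` and storage units `S`. -/
structure Market (G S : Type*) (T : ℕ) where
  /-- inelastic demand -/
  d : Fin T → ℝ
  /-- cost coefficients of the generators -/
  c : G → ℝ
  /-- minimum generation limits -/
  gmin : G → ℝ
  /-- maximum generation limits -/
  gmax : G → ℝ
  /-- storage capacities -/
  E : S → ℝ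
  /-- degradation cost coefficients of the storage units, for example `b_i = ρ B E_i` with a
  coefficient `ρ` of the cycle stress function and a unit capital cost `B` -/
  b : S → ℝ
  /-- initial (and terminal) SoC -/
  x₀ : S → ℝ
  /-- minimum rates -/
  umin : S → ℝ
  /-- maximum rates -/
  umax : S → ℝ
  c_pos : ∀ j, 0 < c j
  E_pos : ∀ i, 0 < E i
  b_pos : ∀ i, 0 < b i

/-- The prices and the other dual variables of the market clearing. -/
structure Duals (G S : Type*) (T : ℕ) where
  /-- market-clearing prices: duals of the power balance -/
  lam : Fin T → ℝ
  /-- per-cycle prices: duals of the Rainflow constraint -/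
  theta : S → Fin T → ℝ
  /-- duals of the minimum generation limits -/
  etaLo : G → Fin T → ℝ
  /-- duals of the maximum generation limits -/
  etaHi : G → Fin T → ℝ
  /-- duals of the periodicity constraints -/
  delta : S → ℝ
  /-- duals of the lower SoC limits -/
  muLo : S → Fin T → ℝ
  /-- duals of the upper SoC limits -/
  muHi : S → Fin T → ℝ
  /-- duals of the minimum rate limits -/
  rateLo : S → Fin T → ℝ
  /-- duals of the maximum rate limits -/
  rateHi : S → Fin T → ℝ

/-- The price `Θ_j = λ + η̲_j - η̄_j` paid to generator `j`. -/
def Duals.genPrice {G S : Type*} {T : ℕ} (p : Duals G S T) (j : G) : Fin T → ℝ :=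
  p.lam + p.etaLo j - p.etaHi j

namespace Market

variable {G S : Type*} [Fintype G] [Fintype S] {T : ℕ}

/-- The constraints on the schedules `g`, `u`: power balance, generation limits, rate limits,
periodicity, and SoC limits. -/
structure Feasible (m : Market G S T) (g : G → Fin T → ℝ) (u : S → Fin T → ℝ) : Prop where
  balance : m.d = ∑ j, g j + ∑ i, u i
  gen : ∀ j t, m.gmin j ≤ g j t ∧ g j t ≤ m.gmax j
  rate : ∀ i t, m.umin i ≤ u i t ∧ u i t ≤ m.umax i
  periodic : ∀ i, ∑ t, u i t = 0
  soc : ∀ i t, m.x₀ i - 1 ≤ (cumMatrix T (m.E i) *ᵥ u i) t ∧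
    (cumMatrix T (m.E i) *ᵥ u i) t ≤ m.x₀ i

/-- The degradation cost `C_i(u) = (b_i / 2) νᵀ ν`, where `ν = Rainflow(x)` is the vector of
half-cycle depths of the SoC profile `x` of `u`. -/
def degradationCost (m : Market G S T) (i : S) (u : Fin T → ℝ) : ℝ :=
  m.b i / 2 * (rainflow (CycleMarket.soc (m.E i) (m.x₀ i) u) ⬝ᵥ
    rainflow (CycleMarket.soc (m.E i) (m.x₀ i) u))

/-- The objective of the social planner. -/
def socialCost (m : Market G S T) (g : G → Fin T → ℝ) (u : S → Fin T → ℝ) : ℝ :=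
  ∑ i, m.degradationCost i (u i) + ∑ j, m.c j / 2 * (g j ⬝ᵥ g j)

/-- `(g, u)` is an optimal solution of the SOCIAL PLANNER problem. -/
def SolvesSocialPlanner (m : Market G S T) (g : G → Fin T → ℝ) (u : S → Fin T → ℝ) : Prop :=
  m.Feasible g u ∧ ∀ g' u', m.Feasible g' u' → m.socialCost g u ≤ m.socialCost g' u'

/-- The vector `N(u) u` for storage unit `i`. -/
def cycleDepths (m : Market G S T) (i : S) (u : Fin T → ℝ) : Fin T → ℝ :=
  cycleMatrix (m.E i) (m.x₀ i) u *ᵥ u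

/-- The constraints of the CYCLE AWARE SYSTEM. -/
def FeasibleCycle (m : Market G S T) (g : G → Fin T → ℝ) (u v : S → Fin T → ℝ) : Prop :=
  m.Feasible g u ∧ ∀ i, v i = m.cycleDepths i (u i)

/-- The objective of the CYCLE AWARE SYSTEM for the bids `α`, `β`; it is meant for positive bids. -/
def bidCost (α : G → ℝ) (β : S → ℝ) (g : G → Fin T → ℝ) (v : S → Fin T → ℝ) : ℝ :=
  ∑ i, 1 / (2 * β i) * (v i ⬝ᵥ v i) + ∑ j, 1 / (2 * α j) * (g j ⬝ᵥ g j)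

/-- `(g, u, v)` is an optimal solution of the CYCLE AWARE SYSTEM for the bids `α`, `β`. -/
def SolvesCycleAware (m : Market G S T) (α : G → ℝ) (β : S → ℝ)
    (g : G → Fin T → ℝ) (u v : S → Fin T → ℝ) : Prop :=
  m.FeasibleCycle g u v ∧
    ∀ g' u' v', m.FeasibleCycle g' u' v' → bidCost α β g v ≤ bidCost α β g' v'

/-- `p` are dual variables of the CYCLE AWARE SYSTEM at `(g, u, v)`: dual feasibility,
complementary slackness and stationarity. The cost `u ↦ (1 / 2β_i) |N(u) u|²` of a storage unit is
convex but not differentiable, so the stationarity condition in `u_i` says that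
`λ - δ_i 𝟏 - Ãᵀ (μ̄_i - μ̲_i) - (ν̄_i - ν̲_i)` is one of its subgradients at `u_i`. -/
structure IsDual (m : Market G S T) (α : G → ℝ) (β : S → ℝ)
    (g : G → Fin T → ℝ) (u v : S → Fin T → ℝ) (p : Duals G S T) : Prop where
  etaLo_nonneg : ∀ j t, 0 ≤ p.etaLo j t
  etaHi_nonneg : ∀ j t, 0 ≤ p.etaHi j t
  muLo_nonneg : ∀ i t, 0 ≤ p.muLo i t
  muHi_nonneg : ∀ i t, 0 ≤ p.muHi i t
  rateLo_nonneg : ∀ i t, 0 ≤ p.rateLo i t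
  rateHi_nonneg : ∀ i t, 0 ≤ p.rateHi i t
  etaLo_slack : ∀ j t, p.etaLo j t * (m.gmin j - g j t) = 0
  etaHi_slack : ∀ j t, p.etaHi j t * (g j t - m.gmax j) = 0
  muLo_slack : ∀ i t, p.muLo i t * (m.x₀ i - 1 - (cumMatrix T (m.E i) *ᵥ u i) t) = 0
  muHi_slack : ∀ i t, p.muHi i t * ((cumMatrix T (m.E i) *ᵥ u i) t - m.x₀ i) = 0
  rateLo_slack : ∀ i t, p.rateLo i t * (m.umin i - u i t) = 0
  rateHi_slack : ∀ i t, p.rateHi i t * (u i t - m.umax i) = 0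
  stationary_g : ∀ j, p.lam = (1 / α j) • g j + p.etaHi j - p.etaLo j
  stationary_v : ∀ i, p.theta i = (1 / β i) • v i
  stationary_u : ∀ i, ∀ u' : Fin T → ℝ,
    1 / (2 * β i) * (m.cycleDepths i (u i) ⬝ᵥ m.cycleDepths i (u i)) +
      (p.lam - (fun _ => p.delta i) - (cumMatrix T (m.E i))ᵀ *ᵥ (p.muHi i - p.muLo i) -
        (p.rateHi i - p.rateLo i)) ⬝ᵥ (u' - u i) ≤
      1 / (2 * β i) * (m.cycleDepths i u' ⬝ᵥ m.cycleDepths i u')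

/-- The market operator clears the market for the (positive) bids `α`, `β`: the dispatch is an
optimal solution of the CYCLE AWARE SYSTEM, and the prices are dual variables. -/
structure IsClearing (m : Market G S T) (α : G → ℝ) (β : S → ℝ)
    (g : G → Fin T → ℝ) (u v : S → Fin T → ℝ) (p : Duals G S T) : Prop where
  gen_bid_pos : ∀ j, 0 < α j
  storage_bid_pos : ∀ i, 0 < β i
  optimal : m.SolvesCycleAware α β g u v
  dual : m.IsDual α β g u v p

/-- The profit `Θᵀ g - (c_j / 2) gᵀ g` of generator `j` at the price `Θ` with the bid `a`, where
`g = a Θ` is the linear supply function. -/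
def genProfit (m : Market G S T) (j : G) (Θ : Fin T → ℝ) (a : ℝ) : ℝ :=
  Θ ⬝ᵥ (a • Θ) - m.c j / 2 * ((a • Θ) ⬝ᵥ (a • Θ))

/-- The profit `θᵀ ν - (b_i / 2) νᵀ ν` of storage unit `i` at the per-cycle price `θ` with the bid
`a`, where `ν = a θ` is the energy-cycling function. -/
def storageProfit (m : Market G S T) (i : S) (θ : Fin T → ℝ) (a : ℝ) : ℝ :=
  θ ⬝ᵥ (a • θ) - m.b i / 2 * ((a • θ) ⬝ᵥ (a • θ))

/-- The bid `a ≥ 0` maximizes the profit of the price-taking generator `j` at the price `Θ`. -/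
def IsOptimalGenBid (m : Market G S T) (j : G) (Θ : Fin T → ℝ) (a : ℝ) : Prop :=
  0 ≤ a ∧ ∀ a' : ℝ, 0 ≤ a' → m.genProfit j Θ a' ≤ m.genProfit j Θ a

/-- The bid `a ≥ 0` maximizes the profit of the price-taking storage unit `i` at the per-cycle
price `θ`. -/
def IsOptimalStorageBid (m : Market G S T) (i : S) (θ : Fin T → ℝ) (a : ℝ) : Prop :=
  0 ≤ a ∧ ∀ a' : ℝ, 0 ≤ a' → m.storageProfit i θ a' ≤ m.storageProfit i θ a

/-- The bids `α`, `β`, with the dispatch `g`, `u`, `v` and the prices `p` of the market clearing,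
form a competitive equilibrium of the cycle aware market. -/
structure IsCompetitiveEquilibrium (m : Market G S T) (α : G → ℝ) (β : S → ℝ)
    (g : G → Fin T → ℝ) (u v : S → Fin T → ℝ) (p : Duals G S T) : Prop where
  clearing : m.IsClearing α β g u v p
  gen_optimal : ∀ j, m.IsOptimalGenBid j (p.genPrice j) (α j)
  storage_optimal : ∀ i, m.IsOptimalStorageBid i (p.theta i) (β i)
  rainflow : ∀ i, m.cycleDepths i (u i) = β i • p.theta i
  demand : m.d = ∑ j, α j • p.genPrice j + ∑ i, u i

/-- The truthful bids `α_j = 1 / c_j` of the generators. -/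
def truthfulGen (m : Market G S T) : G → ℝ := fun j => 1 / m.c j

/-- The truthful bids `β_i = 1 / b_i` of the storage units. -/
def truthfulStorage (m : Market G S T) : S → ℝ := fun i => 1 / m.b i

end Market

end CycleMarket

end

namespace CycleMarket

open Matrix

/-! ### The matrix form of the Rainflow algorithm -/

theorem diffMatrix_mulVec {T : ℕ} (y : Fin (T + 1) → ℝ) (t : Fin T) :
    (diffMatrix T *ᵥ y) t = y t.succ - y t.castSucc := by
  have hne : t.castSucc ≠ t.succ := (Fin.castSucc_lt_succ (i := t)).ne
  have h : ∀ s, diffMatrix T t s * y s =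
      (if s = t.succ then y s else 0) - (if s = t.castSucc then y s else 0) := by
    intro s
    by_cases h1 : s = t.succ
    · simp [diffMatrix, h1, hne.symm]
    · by_cases h2 : s = t.castSucc
      · simp [diffMatrix, h2, hne]
      · simp [diffMatrix, h1, h2]
  simp only [mulVec, dotProduct, h, Finset.sum_sub_distrib, Finset.sum_ite_eq', Finset.mem_univ,
    if_true]

theorem soc_succ_sub {T : ℕ} (E x₀ : ℝ) (u : Fin T → ℝ) (t : Fin T) :
    soc E x₀ u t.succ - soc E x₀ u t.castSucc = -(1 / E) * u t := by
  have h : ∀ s : Fin T, (if s.castSucc < t.succ then u s else 0) =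
      (if s.castSucc < t.castSucc then u s else 0) + (if s = t then u s else 0) := by
    intro s
    rcases lt_trichotomy s t with h | h | h
    · simp [Fin.castSucc_lt_succ_iff, h, h.le, h.ne]
    · simp [h]
    · simp [Fin.castSucc_lt_succ_iff, h.not_ge, h.not_gt, h.ne']
  simp only [soc, h, Finset.sum_add_distrib, Finset.sum_ite_eq', Finset.mem_univ, if_true]
  ring

/-- A vector with the same differences as `x` differs from `x` by a constant. -/
theorem sub_eq_sub_of_diffMatrix_mulVec_eq {T : ℕ} {x y : Fin (T + 1) → ℝ}
    (h : diffMatrix T *ᵥ y = diffMatrix T *ᵥ x) (s t : Fin (T + 1)) : y s - y t = x s - x t := by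
  have key : ∀ s, y s - x s = y 0 - x 0 := by
    intro s
    induction s using Fin.induction with
    | zero => rfl
    | succ k ih =>
      have := congrFun h k
      rw [diffMatrix_mulVec, diffMatrix_mulVec] at this
      linarith
  linarith [key s, key t]

/-- Multiplying by the transposed incidence matrix of `x` a vector with the differences of `x`
gives the half-cycle depths of `x`. -/
theorem incidence_transpose_mulVec {T : ℕ} {x y : Fin (T + 1) → ℝ}
    (h : ∀ s t, y s - y t = x s - x t) : (incidence x)ᵀ *ᵥ y = rainflow x := by
  funext k
  simp only [mulVec, dotProduct, transpose_apply, incidence, of_apply, rainflow]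
  rcases (halfCycles x)[(k : ℕ)]? with _ | ⟨s, t⟩
  · simp
  · by_cases hst : x t ≤ x s
    · simp [hst, sub_mul, Finset.sum_sub_distrib, Pi.single_apply, h,
        abs_of_nonneg (sub_nonneg.2 hst)]
    · have : x s - x t ≤ 0 := by linarith
      simp [hst, sub_mul, Finset.sum_sub_distrib, Pi.single_apply, h, abs_of_nonpos this]

theorem cycleMatrix_mulVec {T : ℕ} (E x₀ : ℝ) (u : Fin T → ℝ) :
    cycleMatrix E x₀ u *ᵥ u = rainflow (soc E x₀ u) := by
  have h : diffMatrix T *ᵥ ((-(1 / E)) • (diffPinv T *ᵥ u)) = diffMatrix T *ᵥ soc E x₀ u := by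
    rw [mulVec_smul, mulVec_mulVec, (diffPinv_isMoorePenrose T).1, one_mulVec]
    funext t
    rw [diffMatrix_mulVec, soc_succ_sub]
    rfl
  rw [← incidence_transpose_mulVec (sub_eq_sub_of_diffMatrix_mulVec_eq h), cycleMatrix,
    smul_mulVec, mulVec_smul, mulVec_mulVec]

/-! ### Homogeneity of the Rainflow algorithm -/

section Affine

variable {T : ℕ} {x y : Fin (T + 1) → ℝ} {r : ℝ}

theorem lt_iff_of_sub_eq_mul (hr : 0 < r) (h : ∀ s t, y s - y t = r * (x s - x t))
    (s t : Fin (T + 1)) : y s < y t ↔ x s < x t := by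
  rw [← sub_pos, h, mul_pos_iff_of_pos_left hr, sub_pos]

theorem addTime_eq_of_sub_eq_mul (hr : 0 < r) (h : ∀ s t, y s - y t = r * (x s - x t)) :
    addTime y = addTime x := by
  have hlt := lt_iff_of_sub_eq_mul hr h
  have heq : ∀ s t, y s = y t ↔ x s = x t := fun s t => by
    rw [← sub_eq_zero, h, mul_eq_zero, or_iff_right hr.ne', sub_eq_zero]
  funext l t
  rcases l with _ | ⟨a, _ | ⟨b, l⟩⟩ <;> simp only [addTime, hlt, heq]

theorem abs_sub_eq_mul (hr : 0 < r) (h : ∀ s t, y s - y t = r * (x s - x t))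
    (s t : Fin (T + 1)) : |y s - y t| = r * |x s - x t| := by
  rw [h, abs_mul, abs_of_pos hr]

theorem extractCycle_eq_of_sub_eq_mul (hr : 0 < r) (h : ∀ s t, y s - y t = r * (x s - x t)) :
    ∀ l, extractCycle y l = extractCycle x l
  | s₁ :: s₂ :: s₃ :: s₄ :: l => by
      simp only [extractCycle, abs_sub_eq_mul hr h, mul_le_mul_iff_right₀ hr,
        extractCycle_eq_of_sub_eq_mul hr h (s₂ :: s₃ :: s₄ :: l)]
  | [] | [_] | [_, _] | [_, _, _] => by simp only [extractCycle]

theorem countCycles_eq_of_sub_eq_mul (hr : 0 < r) (h : ∀ s t, y s - y t = r * (x s - x t))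
    (n : ℕ) (l : List (Fin (T + 1))) : countCycles y n l = countCycles x n l := by
  induction n generalizing l with
  | zero => rfl
  | succ n ih => simp only [countCycles, extractCycle_eq_of_sub_eq_mul hr h, ih]

theorem rainflow_eq_smul_of_sub_eq_mul (hr : 0 < r) (h : ∀ s t, y s - y t = r * (x s - x t)) :
    rainflow y = r • rainflow x := by
  have hc : halfCycles y = halfCycles x := by
    simp only [halfCycles, switchingTimes, addTime_eq_of_sub_eq_mul hr h,
      countCycles_eq_of_sub_eq_mul hr h]
  funext k
  simp only [rainflow, hc, Pi.smul_apply, smul_eq_mul]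
  rcases (halfCycles x)[(k : ℕ)]? with _ | ⟨s, t⟩
  · simp
  · exact abs_sub_eq_mul hr h s t

end Affine

theorem soc_smul_sub {T : ℕ} (E x₀ r : ℝ) (u : Fin T → ℝ) (s t : Fin (T + 1)) :
    soc E x₀ (r • u) s - soc E x₀ (r • u) t = r * (soc E x₀ u s - soc E x₀ u t) := by
  have h : ∀ s : Fin (T + 1), (∑ k : Fin T, if k.castSucc < s then (r • u) k else 0) =
      r * ∑ k : Fin T, if k.castSucc < s then u k else 0 := fun s => by
    simp [Finset.mul_sum]
  simp only [soc, h]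
  ring

namespace Market

variable {G S : Type*} {T : ℕ}

theorem cycleDepths_eq_rainflow (m : Market G S T) (i : S) (u : Fin T → ℝ) :
    m.cycleDepths i u = rainflow (CycleMarket.soc (m.E i) (m.x₀ i) u) :=
  cycleMatrix_mulVec _ _ _

theorem cycleDepths_smul (m : Market G S T) (i : S) {r : ℝ} (hr : 0 < r) (u : Fin T → ℝ) :
    m.cycleDepths i (r • u) = r • m.cycleDepths i u := by
  simp only [cycleDepths_eq_rainflow]
  exact rainflow_eq_smul_of_sub_eq_mul hr (soc_smul_sub _ _ _ _)

/-! ### Optimal bids -/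

theorem dotProduct_self_nonneg (p : Fin T → ℝ) : 0 ≤ p ⬝ᵥ p :=
  Finset.sum_nonneg fun t _ => mul_self_nonneg (p t)

/-- The profit of a linear bid falls short of the truthful profit by a square. -/
theorem linear_bid_profit {c : ℝ} (hc : 0 < c) (p : Fin T → ℝ) (a : ℝ) :
    p ⬝ᵥ (a • p) - c / 2 * ((a • p) ⬝ᵥ (a • p)) =
      1 / (2 * c) * (p ⬝ᵥ p) - c / 2 * (a - 1 / c) ^ 2 * (p ⬝ᵥ p) := by
  simp only [dotProduct_smul, smul_dotProduct, smul_eq_mul]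
  field_simp
  ring

theorem linear_bid_truthful_optimal {c : ℝ} (hc : 0 < c) (p : Fin T → ℝ) (a : ℝ) :
    p ⬝ᵥ (a • p) - c / 2 * ((a • p) ⬝ᵥ (a • p)) ≤
      p ⬝ᵥ ((1 / c) • p) - c / 2 * (((1 / c) • p) ⬝ᵥ ((1 / c) • p)) := by
  rw [linear_bid_profit hc, linear_bid_profit hc p (1 / c)]
  have := dotProduct_self_nonneg p
  have : 0 ≤ c / 2 * (a - 1 / c) ^ 2 * (p ⬝ᵥ p) := by positivity
  simpa using this

theorem linear_bid_eq_truthful {c : ℝ} (hc : 0 < c) {p : Fin T → ℝ} (hp : p ≠ 0) {a : ℝ}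
    (h : p ⬝ᵥ ((1 / c) • p) - c / 2 * (((1 / c) • p) ⬝ᵥ ((1 / c) • p)) ≤
      p ⬝ᵥ (a • p) - c / 2 * ((a • p) ⬝ᵥ (a • p))) : a = 1 / c := by
  rw [linear_bid_profit hc, linear_bid_profit hc p a] at h
  have hpp : 0 < p ⬝ᵥ p :=
    (dotProduct_self_nonneg p).lt_of_ne' (mt dotProduct_self_eq_zero.1 hp)
  by_contra hne
  have : 0 < (a - 1 / c) ^ 2 := by have := sub_ne_zero.2 hne; positivity
  have : 0 < c / 2 * (a - 1 / c) ^ 2 * (p ⬝ᵥ p) := by positivity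
  simp only [sub_self] at h
  linarith

theorem isOptimalGenBid_truthful (m : Market G S T) (j : G) (Θ : Fin T → ℝ) :
    m.IsOptimalGenBid j Θ (1 / m.c j) :=
  ⟨(one_div_pos.2 (m.c_pos j)).le, fun a _ => linear_bid_truthful_optimal (m.c_pos j) Θ a⟩

theorem isOptimalStorageBid_truthful (m : Market G S T) (i : S) (θ : Fin T → ℝ) :
    m.IsOptimalStorageBid i θ (1 / m.b i) :=
  ⟨(one_div_pos.2 (m.b_pos i)).le, fun a _ => linear_bid_truthful_optimal (m.b_pos i) θ a⟩

theorem IsOptimalGenBid.eq_truthful {m : Market G S T} {j : G} {Θ : Fin T → ℝ} {a : ℝ}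
    (h : m.IsOptimalGenBid j Θ a) (hΘ : Θ ≠ 0) : a = 1 / m.c j :=
  linear_bid_eq_truthful (m.c_pos j) hΘ (h.2 _ (one_div_pos.2 (m.c_pos j)).le)

theorem IsOptimalStorageBid.eq_truthful {m : Market G S T} {i : S} {θ : Fin T → ℝ} {a : ℝ}
    (h : m.IsOptimalStorageBid i θ a) (hθ : θ ≠ 0) : a = 1 / m.b i :=
  linear_bid_eq_truthful (m.b_pos i) hθ (h.2 _ (one_div_pos.2 (m.b_pos i)).le)

/-! ### Optimality conditions -/

theorem degradationCost_eq (m : Market G S T) (i : S) (u : Fin T → ℝ) :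
    m.degradationCost i u = m.b i / 2 * (m.cycleDepths i u ⬝ᵥ m.cycleDepths i u) := by
  rw [degradationCost, cycleDepths_eq_rainflow]

/-- A subgradient of the cycling cost at a profile without cycles is a nonpositive functional, up
to the value at that profile, since the cost is positively homogeneous of degree two. -/
theorem dotProduct_sub_nonpos_of_cycleDepths_eq_zero (m : Market G S T) (i : S) {k : ℝ}
    {s u : Fin T → ℝ} (h0 : m.cycleDepths i u = 0)
    (hs : ∀ u', k * (m.cycleDepths i u ⬝ᵥ m.cycleDepths i u) + s ⬝ᵥ (u' - u) ≤
      k * (m.cycleDepths i u' ⬝ᵥ m.cycleDepths i u')) (u' : Fin T → ℝ) :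
    s ⬝ᵥ (u' - u) ≤ 0 := by
  simp only [h0, dotProduct_zero, mul_zero, zero_add, dotProduct_sub] at hs ⊢
  have hscale : ∀ (w : Fin T → ℝ) (r : ℝ), 0 < r →
      r * (s ⬝ᵥ w) - s ⬝ᵥ u ≤ k * (r ^ 2 * (m.cycleDepths i w ⬝ᵥ m.cycleDepths i w)) := by
    intro w r hr
    have := hs (r • w)
    rw [cycleDepths_smul m i hr] at this
    simp only [dotProduct_smul, smul_dotProduct, smul_eq_mul] at this
    calc _ ≤ _ := this
      _ = _ := by ring
  have hu : s ⬝ᵥ u = 0 := by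
    have h1 := hscale u 2 (by norm_num)
    have h2 := hscale u (1 / 2) (by norm_num)
    simp only [h0, dotProduct_zero, mul_zero] at h1 h2
    linarith
  rw [hu, sub_zero]
  by_contra! hpos
  set q := m.cycleDepths i u' ⬝ᵥ m.cycleDepths i u'
  have hr : 0 < (s ⬝ᵥ u') / (2 * (|k * q| + 1)) := by positivity
  have h := hscale u' _ hr
  rw [hu, sub_zero] at h
  set r := (s ⬝ᵥ u') / (2 * (|k * q| + 1)) with hrdef
  have h1 : s ⬝ᵥ u' ≤ r * (k * q) := by
    refine le_of_mul_le_mul_left ?_ hr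
    calc _ ≤ _ := h
      _ = _ := by ring
  have h2 : r * (2 * (|k * q| + 1)) = s ⬝ᵥ u' := by rw [hrdef]; field_simp
  nlinarith [le_abs_self (k * q), abs_nonneg (k * q)]

theorem dotProduct_sub_nonneg_of_slack {p z z' l : Fin T → ℝ} (hp : ∀ t, 0 ≤ p t)
    (hslack : ∀ t, p t * (l t - z t) = 0) (hz' : ∀ t, l t ≤ z' t) : 0 ≤ p ⬝ᵥ (z' - z) :=
  Finset.sum_nonneg fun t _ => by
    have := mul_nonneg (hp t) (sub_nonneg.2 (hz' t))
    have := hslack t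
    simp only [Pi.sub_apply]
    linarith [mul_sub (p t) (l t) (z t), mul_sub (p t) (z' t) (z t), mul_sub (p t) (z' t) (l t)]

theorem dotProduct_sub_nonpos_of_slack {p z z' h : Fin T → ℝ} (hp : ∀ t, 0 ≤ p t)
    (hslack : ∀ t, p t * (z t - h t) = 0) (hz' : ∀ t, z' t ≤ h t) : p ⬝ᵥ (z' - z) ≤ 0 :=
  Finset.sum_nonpos fun t _ => by
    have := mul_nonneg (hp t) (sub_nonneg.2 (hz' t))
    have := hslack t
    simp only [Pi.sub_apply]
    linarith [mul_sub (p t) (z t) (h t), mul_sub (p t) (z' t) (z t), mul_sub (p t) (h t) (z' t)]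

theorem half_sq_ge_tangent {c : ℝ} (hc : 0 ≤ c) (x y : Fin T → ℝ) :
    c / 2 * (x ⬝ᵥ x) + (c • x) ⬝ᵥ (y - x) ≤ c / 2 * (y ⬝ᵥ y) := by
  have h := mul_nonneg (div_nonneg hc two_pos.le) (dotProduct_self_nonneg (y - x))
  simp only [sub_dotProduct, dotProduct_sub, smul_dotProduct, smul_eq_mul] at h ⊢
  rw [dotProduct_comm y x] at h
  linarith

/-- Dual variables for which every dispatched generator bids its cost and every cycled storage
unit its degradation cost certify optimality for the social planner. -/
theorem IsDual.solvesSocialPlanner [Fintype G] [Fintype S] {m : Market G S T} {α : G → ℝ}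
    {β : S → ℝ} {g : G → Fin T → ℝ} {u v : S → Fin T → ℝ} {p : Duals G S T}
    (hp : m.IsDual α β g u v p) (hgu : m.Feasible g u)
    (hg : ∀ j, m.c j • g j = p.genPrice j)
    (hβ : ∀ i, m.cycleDepths i (u i) = 0 ∨ β i = 1 / m.b i) :
    m.SolvesSocialPlanner g u := by
  refine ⟨hgu, fun g' u' h' => ?_⟩
  have hG : ∀ j, m.c j / 2 * (g j ⬝ᵥ g j) + p.lam ⬝ᵥ (g' j - g j) ≤
      m.c j / 2 * (g' j ⬝ᵥ g' j) := by
    intro j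
    have h1 := half_sq_ge_tangent (m.c_pos j).le (g j) (g' j)
    have h2 := dotProduct_sub_nonneg_of_slack (hp.etaLo_nonneg j)
      (l := fun _ => m.gmin j) (hp.etaLo_slack j) (fun t => (h'.gen j t).1)
    have h3 := dotProduct_sub_nonpos_of_slack (hp.etaHi_nonneg j)
      (h := fun _ => m.gmax j) (hp.etaHi_slack j) (fun t => (h'.gen j t).2)
    rw [hg, Duals.genPrice, sub_dotProduct, add_dotProduct] at h1
    linarith
  have hS : ∀ i, m.degradationCost i (u i) + p.lam ⬝ᵥ (u' i - u i) ≤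
      m.degradationCost i (u' i) := by
    intro i
    have h1 : m.degradationCost i (u i) +
        (p.lam - (fun _ => p.delta i) - (cumMatrix T (m.E i))ᵀ *ᵥ (p.muHi i - p.muLo i) -
        (p.rateHi i - p.rateLo i)) ⬝ᵥ (u' i - u i) ≤ m.degradationCost i (u' i) := by
      rw [degradationCost_eq, degradationCost_eq]
      rcases hβ i with h0 | hb
      · have h := dotProduct_sub_nonpos_of_cycleDepths_eq_zero m i h0 (hp.stationary_u i) (u' i)
        have := mul_nonneg (half_pos (m.b_pos i)).le
          (dotProduct_self_nonneg (m.cycleDepths i (u' i)))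
        rw [h0, dotProduct_zero, mul_zero]
        linarith
      · have h := hp.stationary_u i (u' i)
        have hb' : 1 / (2 * β i) = m.b i / 2 := by
          have := (m.b_pos i).ne'
          rw [hb]; field_simp
        rwa [hb'] at h
    have hδ : (fun _ => p.delta i) ⬝ᵥ (u' i - u i) = 0 := by
      simp only [dotProduct, Pi.sub_apply, ← Finset.mul_sum, Finset.sum_sub_distrib,
        h'.periodic i, hgu.periodic i, sub_self, mul_zero]
    have hμ : ((cumMatrix T (m.E i))ᵀ *ᵥ (p.muHi i - p.muLo i)) ⬝ᵥ (u' i - u i) =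
        p.muHi i ⬝ᵥ (cumMatrix T (m.E i) *ᵥ u' i - cumMatrix T (m.E i) *ᵥ u i) -
        p.muLo i ⬝ᵥ (cumMatrix T (m.E i) *ᵥ u' i - cumMatrix T (m.E i) *ᵥ u i) := by
      rw [mulVec_transpose, ← dotProduct_mulVec, mulVec_sub, sub_dotProduct]
    have h2 := dotProduct_sub_nonneg_of_slack (hp.muLo_nonneg i)
      (l := fun _ => m.x₀ i - 1) (hp.muLo_slack i) (fun t => (h'.soc i t).1)
    have h3 := dotProduct_sub_nonpos_of_slack (hp.muHi_nonneg i)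
      (h := fun _ => m.x₀ i) (hp.muHi_slack i) (fun t => (h'.soc i t).2)
    have h4 := dotProduct_sub_nonneg_of_slack (hp.rateLo_nonneg i)
      (l := fun _ => m.umin i) (hp.rateLo_slack i) (fun t => (h'.rate i t).1)
    have h5 := dotProduct_sub_nonpos_of_slack (hp.rateHi_nonneg i)
      (h := fun _ => m.umax i) (hp.rateHi_slack i) (fun t => (h'.rate i t).2)
    rw [sub_dotProduct, sub_dotProduct, sub_dotProduct, hδ, hμ,
      sub_dotProduct (p.rateHi i)] at h1
    linarith
  have hbal : ∑ j, p.lam ⬝ᵥ (g' j - g j) + ∑ i, p.lam ⬝ᵥ (u' i - u i) = 0 := by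
    rw [← dotProduct_sum, ← dotProduct_sum, ← dotProduct_add, Finset.sum_sub_distrib,
      Finset.sum_sub_distrib, sub_add_sub_comm, ← h'.balance, ← hgu.balance, sub_self,
      dotProduct_zero]
  have h1 := Finset.sum_le_sum fun j (_ : j ∈ Finset.univ) => hG j
  have h2 := Finset.sum_le_sum fun i (_ : i ∈ Finset.univ) => hS i
  rw [Finset.sum_add_distrib] at h1 h2
  rw [socialCost, socialCost]
  linarith

/-! ### Equilibria -/

section Equilibrium

variable [Fintype G] [Fintype S] {m : Market G S T} {α : G → ℝ} {β : S → ℝ}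
  {g : G → Fin T → ℝ} {u v : S → Fin T → ℝ} {p : Duals G S T}

/-- A cleared generator produces the quantity of its supply function. -/
theorem IsClearing.smul_genPrice (h : m.IsClearing α β g u v p) (j : G) :
    α j • p.genPrice j = g j := by
  have : p.genPrice j = (1 / α j) • g j := by
    rw [Duals.genPrice, h.dual.stationary_g j]
    abel
  rw [this, smul_smul, mul_one_div_cancel (h.gen_bid_pos j).ne', one_smul]

/-- A cleared storage unit cycles the depths of its energy-cycling function. -/
theorem IsClearing.cycleDepths_eq (h : m.IsClearing α β g u v p) (i : S) :
    m.cycleDepths i (u i) = β i • p.theta i := by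
  rw [h.dual.stationary_v i, smul_smul, mul_one_div_cancel (h.storage_bid_pos i).ne', one_smul,
    h.optimal.1.2 i]

theorem IsCompetitiveEquilibrium.solvesSocialPlanner
    (h : m.IsCompetitiveEquilibrium α β g u v p) : m.SolvesSocialPlanner g u := by
  refine h.clearing.dual.solvesSocialPlanner h.clearing.optimal.1.1 (fun j => ?_) (fun i => ?_)
  · rw [← h.clearing.smul_genPrice j]
    by_cases hΘ : p.genPrice j = 0
    · simp [hΘ]
    · rw [(h.gen_optimal j).eq_truthful hΘ, smul_smul, mul_one_div_cancel (m.c_pos j).ne',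
        one_smul]
  · by_cases hθ : p.theta i = 0
    · exact .inl (by rw [h.rainflow i, hθ, smul_zero])
    · exact .inr ((h.storage_optimal i).eq_truthful hθ)

theorem IsClearing.isCompetitiveEquilibrium
    (h : m.IsClearing m.truthfulGen m.truthfulStorage g u v p) :
    m.IsCompetitiveEquilibrium m.truthfulGen m.truthfulStorage g u v p where
  clearing := h
  gen_optimal j := m.isOptimalGenBid_truthful j _
  storage_optimal i := m.isOptimalStorageBid_truthful i _
  rainflow := h.cycleDepths_eq
  demand := by
    simp only [h.smul_genPrice]
    exact h.optimal.1.1.balance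

/-- At truthful bids the objective of the market operator is the social cost. -/
theorem bidCost_truthful (m : Market G S T) (g : G → Fin T → ℝ) (u : S → Fin T → ℝ) :
    bidCost m.truthfulGen m.truthfulStorage g (fun i => m.cycleDepths i (u i)) =
      m.socialCost g u := by
  have h : ∀ c : ℝ, 1 / (2 * (1 / c)) = c / 2 := fun c => by
    rw [mul_one_div, one_div_div]
  simp only [bidCost, socialCost, degradationCost_eq, truthfulGen, truthfulStorage, h]

theorem solvesCycleAware_truthful_iff :
    m.SolvesCycleAware m.truthfulGen m.truthfulStorage g u v ↔
      m.SolvesSocialPlanner g u ∧ ∀ i, v i = m.cycleDepths i (u i) := by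
  constructor
  · rintro ⟨⟨hf, hv⟩, hopt⟩
    refine ⟨⟨hf, fun g' u' h' => ?_⟩, hv⟩
    have := hopt g' u' _ ⟨h', fun _ => rfl⟩
    rwa [funext hv, bidCost_truthful, bidCost_truthful] at this
  · rintro ⟨⟨hf, hopt⟩, hv⟩
    refine ⟨⟨hf, hv⟩, fun g' u' v' h' => ?_⟩
    rw [funext hv, funext h'.2, bidCost_truthful, bidCost_truthful]
    exact hopt g' u' h'.1

end Equilibrium

end Market

end CycleMarket

theorem mainTheorem1 {G S : Type*} [Fintype G] [Fintype S] {T : ℕ}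
    (m : CycleMarket.Market G S T) :
    -- truthful bids maximize profit at all prices, and only they do so at nonzero prices
    (∀ j Θ, m.IsOptimalGenBid j Θ (1 / m.c j) ∧
      (Θ ≠ 0 → ∀ a, m.IsOptimalGenBid j Θ a → a = 1 / m.c j)) ∧
    (∀ i θ, m.IsOptimalStorageBid i θ (1 / m.b i) ∧
      (θ ≠ 0 → ∀ a, m.IsOptimalStorageBid i θ a → a = 1 / m.b i)) ∧
    -- every competitive equilibrium has truthful bids and solves the social planner problem
    (∀ α β g u v p, m.IsCompetitiveEquilibrium α β g u v p →
      (∀ j, p.genPrice j ≠ 0 → α j = 1 / m.c j) ∧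
      (∀ i, p.theta i ≠ 0 → β i = 1 / m.b i) ∧
      m.SolvesSocialPlanner g u) ∧
    -- truthful bids form a competitive equilibrium
    (∀ g u v p, m.IsClearing m.truthfulGen m.truthfulStorage g u v p →
      m.IsCompetitiveEquilibrium m.truthfulGen m.truthfulStorage g u v p) ∧
    -- with truthful bids, the market clearing is the social planner problem
    (∀ g u v, m.SolvesCycleAware m.truthfulGen m.truthfulStorage g u v ↔
      m.SolvesSocialPlanner g u ∧
        ∀ i, v i = CycleMarket.rainflow (CycleMarket.soc (m.E i) (m.x₀ i) (u i))) := by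
  refine ⟨fun j Θ => ⟨m.isOptimalGenBid_truthful j Θ, fun hΘ a h => h.eq_truthful hΘ⟩,
    fun i θ => ⟨m.isOptimalStorageBid_truthful i θ, fun hθ a h => h.eq_truthful hθ⟩,
    fun α β g u v p h => ⟨fun j => (h.gen_optimal j).eq_truthful,
      fun i => (h.storage_optimal i).eq_truthful, h.solvesSocialPlanner⟩,
    fun g u v p h => h.isCompetitiveEquilibrium, fun g u v => ?_⟩
  simp only [← CycleMarket.Market.cycleDepths_eq_rainflow]
  exact CycleMarket.Market.solvesCycleAware_truthful_iff
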